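/- Let $S$ be a measurable space, $\varphi:S^2\to\mathbb R$ a bounded measurable function with $\|\varphi\|_\infty=\sup_{z\in S^2}|\varphi(z)|$ (if $\varphi$ is unbounded, $\|\varphi\|_\infty=+\infty$ and the bounds below are void), and $n\ge 2$. For a sample $\mathbb x_n=(x_1,\dots,x_n)$ of couples $x_i=(x_i^1,x_i^2)\in S^2$ put $$T(\mathbb x_n)=\frac1{n-1}\Big(\sum_{i=1}^n\varphi(x_i^1,x_i^2)-\frac1n\sum_{i,j=1}^n\varphi(x_i^1,x_j^2)\Big),$$ and for a permutation $\pi$ of $\{1,\dots,n\}$ let $\mathbb x_n^{\pi}$ be the permuted sample with $i$-th element $(x_i^1,x_{\pi(i)}^2)$. Let $T^{(1)}(\mathbb x_n)\le\dots\le T^{(n!)}(\mathbb x_n)$ be the ordered values (with multiplicity) of $T(\mathbb x_n^{\pi})$ over all $n!$ permutations $\pi$. For $\alpha\in(0,1)$ the critical value of the permutation test of independence is $$q_{1-\alpha}(\mathbb x_n)=T^{(n!-\lfloor n!\alpha\rfloor)}(\mathbb x_n),$$ that is, the $(1-\alpha)$-quantile of $T(\mathbb x_n^{\Pi_n})$ for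 a uniformly distributed random permutation $\Pi_n$. **Proposition.** There exist universal constants $C'>0$ and $c_0\ge 1$ (independent of $S,\varphi,n,\alpha$ and the sample) such that, for all $S,\varphi,n,\alpha$ as above and every sample $\mathbb x_n\in(S^2)^n$, $$q_{1-\alpha}(\mathbb x_n)\le\frac{C'}{n-1}\left\{\sqrt{\frac1n\sum_{i,j=1}^n\varphi^2(x_i^1,x_j^2)}\,\sqrt{\ln\Big(\frac{c_0}{\alpha}\Big)}+\|\varphi\|_\infty\ln\Big(\frac{c_0}{\alpha}\Big)\right\}.$$ As a consequence, there exists a universal constant $C>0$ such that, for all $S,\varphi,n,\alpha$ as above, every $\beta\in(0,1)$, every probability measure $P$ on $S^2$ with marginals $P^1$ and $P^2$, and every i.i.d. sample $\mathbb X_n=(X_1,\dots,X_n)$ with distribution $P$, the $(1-\beta/2)$-quantile $q^{\alpha}_{1-\beta/2}=\inf\{t\in\mathbb R:\mathbb P(q_{1-\alpha}(\mathbb X_n)\le t)\ge 1-\beta/2\}$ of the critical value satisfies $$q^{\alpha}_{1-\beta/2}\le C\left\{\sqrt{\frac2\beta\ln\Big(\frac{c_0}{\alpha}\Big)}\left(\frac{\sqrt{\mathbb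 E_P[\varphi^2]}}{n}+\frac{\sqrt{\mathbb E_{\perp\!\!\!\perp}[\varphi^2]}}{\sqrt n}\right)+\frac{\|\varphi\|_\infty}{n}\ln\Big(\frac{c_0}{\alpha}\Big)\right\},$$ where $\mathbb E_P[g]=\int g\,dP$ and $\mathbb E_{\perp\!\!\!\perp}[g]=\int g\,d(P^1\otimes P^2)$. -/

import Mathlib

open MeasureTheory ProbabilityTheory

noncomputable section

namespace PermTest

/-- The statistic
`T(x) = (1/(n-1)) * (∑ i, φ(x_i¹, x_i²) - (1/n) * ∑ i j, φ(x_i¹, x_j²))`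
of a sample `x = (x_1, …, x_n)` of couples `x_i = (x_i¹, x_i²)`. -/
def testStat {S : Type*} {n : ℕ} (φ : S × S → ℝ) (x : Fin n → S × S) : ℝ :=
  1 / ((n : ℝ) - 1) *
    (∑ i, φ ((x i).1, (x i).2) - 1 / (n : ℝ) * ∑ i, ∑ j, φ ((x i).1, (x j).2))

/-- The permuted sample: only the second coordinates are permuted. -/
def permSample {S : Type*} {n : ℕ} (x : Fin n → S × S) (π : Equiv.Perm (Fin n)) :
    Fin n → S × S :=
  fun i => ((x i).1, (x (π i)).2)

/-- All the values of a finite family of reals, repeated with multiplicity,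
in non-decreasing order. -/
def orderedValues {ι : Type*} [Fintype ι] (f : ι → ℝ) : List ℝ :=
  (Finset.univ.val.map f).sort (· ≤ ·)

/-- The `k`-th smallest value `f^(k)` of a finite family, for `1 ≤ k ≤ card ι`
(lists are indexed from `0`; the default value `0` is used only for other `k`). -/
def orderStat {ι : Type*} [Fintype ι] (f : ι → ℝ) (k : ℕ) : ℝ :=
  (orderedValues f).getD (k - 1) 0

/-- The critical value `q_{1-α}(x) = T^(n! - ⌊n! α⌋)(x)` of the permutation test, an order
statistic of the family of the permuted statistics `T(x^π)` over all permutations `π`.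
For `0 < α < 1` the rank lies between `1` and `n!`. -/
def criticalValue {S : Type*} {n : ℕ} (φ : S × S → ℝ) (α : ℝ) (x : Fin n → S × S) : ℝ :=
  orderStat (fun π : Equiv.Perm (Fin n) => testStat φ (permSample x π))
    (n.factorial - ⌊(n.factorial : ℝ) * α⌋₊)

/-- The `p`-quantile `inf {t | P(Y ≤ t) ≥ p}` of a real random variable `Y`. -/
def quantile {Ω : Type*} [MeasurableSpace Ω] (μ : Measure Ω) (Y : Ω → ℝ) (p : ℝ) : ℝ :=
  sInf {t : ℝ | p ≤ μ.real {ω | Y ω ≤ t}}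

/-- The supremum norm (used for bounded functions only). -/
def supNorm {T : Type*} (g : T → ℝ) : ℝ := ⨆ z, |g z|

/-- The expectation of `g` under `P`. -/
def expJoint {S : Type*} [MeasurableSpace S] (P : Measure (S × S)) (g : S × S → ℝ) : ℝ :=
  ∫ z, g z ∂P

/-- The expectation of `g` under the product `P¹ ⊗ P²` of the marginals of `P`. -/
def expIndep {S : Type*} [MeasurableSpace S] (P : Measure (S × S)) (g : S × S → ℝ) : ℝ :=
  ∫ z, g z ∂(P.fst.prod P.snd)

end PermTest

end

/-! Up to the factor 1/(n-1), the permuted statistic is a centered permutation sum A(π) - E A, with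
A(π) = ∑ a i (π i) and a i j = φ(x_i¹, x_j²). The first bound is a Bernstein inequality for A,
proved by exchangeable pairs (Chatterjee's method): π is paired with π composed with a random
transposition.

The identity `sum_centered_mul` rewrites E[(A - E A) exp W] through increments under transpositions,
and `sum_centered_mul_exp_le` bounds it when |ΔA| |ΔW| is dominated by the entries of a nonnegative
matrix d. Let D be the permutation sum of d = a² and V its mean. Since |ΔA|² is controlled by the
four squared entries involved, hence by D + V rather than by V alone, the exponential moment is
taken of θ(A - E A) - 4θ²D. The random D is then bounded by a separate exponential moment
(self-bounding, entries in [0, M²]). A union bound and a choice of θ give `card_bernstein_le`.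

A tail count of at most n! α bounds the order statistic. For the second bound, Markov's inequality
is applied to the only random term, the mean of squares V. -/

namespace PermTest

/-! ### Exchangeable pairs for uniform permutations -/

section Exchangeable

variable {ι : Type*} [Fintype ι]

/-- The sum `∑ i, a i (π i)` of the entries of a matrix along a permutation. -/
def permSum (a : ι → ι → ℝ) (π : Equiv.Perm ι) : ℝ := ∑ i, a i (π i)

/-- The mean of `permSum a` under the uniform distribution on permutations. -/
noncomputable def permMean (a : ι → ι → ℝ) : ℝ :=
  1 / (Fintype.card ι : ℝ) * ∑ i, ∑ j, a i j

lemma permSum_nonneg {a : ι → ι → ℝ} (h : ∀ i j, 0 ≤ a i j) (π : Equiv.Perm ι) :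
    0 ≤ permSum a π :=
  Finset.sum_nonneg fun i _ => h i (π i)

lemma permMean_nonneg {a : ι → ι → ℝ} (h : ∀ i j, 0 ≤ a i j) : 0 ≤ permMean a :=
  mul_nonneg (by positivity) (Finset.sum_nonneg fun i _ => Finset.sum_nonneg fun j _ => h i j)

lemma sum_sum_comp_perm (a : ι → ι → ℝ) (π : Equiv.Perm ι) :
    ∑ i, ∑ j, a i (π j) = ∑ i, ∑ j, a i j :=
  Finset.sum_congr rfl fun i _ => Equiv.sum_comp π (a i)

/-- The sum of the four entries of a matrix involved in swapping the images of `i` and `j`. -/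
def swapEntries {κ : Type*} (d : κ → κ → ℝ) (π : Equiv.Perm κ) (i j : κ) : ℝ :=
  d i (π i) + d j (π j) + (d i (π j) + d j (π i))

lemma sum_swapEntries [Nonempty ι] (d : ι → ι → ℝ) (π : Equiv.Perm ι) :
    ∑ i, ∑ j, swapEntries d π i j =
      2 * (Fintype.card ι : ℝ) * (permSum d π + permMean d) := by
  have h0 : (Fintype.card ι : ℝ) ≠ 0 := by simp
  have h : ∑ i, ∑ j, d j (π i) = ∑ i, ∑ j, d i j := by
    rw [Finset.sum_comm, sum_sum_comp_perm]
  simp only [swapEntries, Finset.sum_add_distrib, sum_sum_comp_perm, h, Finset.sum_const,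
    Finset.card_univ, nsmul_eq_mul, permSum, permMean, ← Finset.mul_sum]
  field_simp
  ring

/-- The swap only exchanges the two diagonal terms with the two cross terms. This symmetry lets a
bound in `swapEntries` serve both members of the exchangeable pair. -/
lemma swapEntries_swap {κ : Type*} [DecidableEq κ] (d : κ → κ → ℝ) (π : Equiv.Perm κ)
    (i j : κ) :
    swapEntries d (π * Equiv.swap i j) i j = swapEntries d π i j := by
  simp only [swapEntries, Equiv.Perm.mul_apply, Equiv.swap_apply_left, Equiv.swap_apply_right]
  ring

variable [DecidableEq ι]

lemma permSum_sub_swap (a : ι → ι → ℝ) (π : Equiv.Perm ι) (i j : ι) :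
    permSum a π - permSum a (π * Equiv.swap i j) =
      a i (π i) + a j (π j) - (a i (π j) + a j (π i)) := by
  unfold permSum
  rcases eq_or_ne i j with rfl | hij
  · simp
  · rw [← Finset.sum_sub_distrib, Fintype.sum_eq_add i j hij]
    · simp only [Equiv.Perm.mul_apply, Equiv.swap_apply_left, Equiv.swap_apply_right]
      ring
    · rintro x ⟨h1, h2⟩
      simp [Equiv.swap_apply_of_ne_of_ne h1 h2]

lemma abs_permSum_sub_swap_le_swapEntries {d : ι → ι → ℝ} (hd : ∀ i j, 0 ≤ d i j)
    (π : Equiv.Perm ι) (i j : ι) :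
    |permSum d π - permSum d (π * Equiv.swap i j)| ≤ swapEntries d π i j := by
  rw [permSum_sub_swap, swapEntries, abs_le]
  constructor <;> linarith [hd i (π i), hd j (π j), hd i (π j), hd j (π i)]

/-- Stein's linear regression property: averaged over transpositions, the increment is proportional
to the centered sum, because the cross terms run over the whole matrix. Pairs with i = j contribute
0. -/
lemma sum_permSum_sub_swap [Nonempty ι] (a : ι → ι → ℝ) (π : Equiv.Perm ι) :
    ∑ i, ∑ j, (permSum a π - permSum a (π * Equiv.swap i j)) =
      2 * (Fintype.card ι : ℝ) * (permSum a π - permMean a) := by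
  have h0 : (Fintype.card ι : ℝ) ≠ 0 := by simp
  have h : ∑ i, ∑ j, a j (π i) = ∑ i, ∑ j, a i j := by
    rw [Finset.sum_comm, sum_sum_comp_perm]
  simp only [permSum_sub_swap]
  simp only [Finset.sum_add_distrib, Finset.sum_sub_distrib, sum_sum_comp_perm,
    h, Finset.sum_const, Finset.card_univ, nsmul_eq_mul, permSum, permMean, ← Finset.mul_sum]
  field_simp
  ring

lemma sum_mul_swap_comp (i j : ι) (f : Equiv.Perm ι → ℝ) :
    ∑ π, f (π * Equiv.swap i j) = ∑ π, f π :=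
  Equiv.sum_comp (Equiv.mulRight (Equiv.swap i j)) f

/-- The exchangeable pairs identity for the uniform permutation and a random transposition. -/
lemma sum_centered_mul [Nonempty ι] (a : ι → ι → ℝ) (g : Equiv.Perm ι → ℝ) :
    4 * (Fintype.card ι : ℝ) * ∑ π, (permSum a π - permMean a) * g π =
      ∑ i, ∑ j, ∑ π, (permSum a π - permSum a (π * Equiv.swap i j)) *
        (g π - g (π * Equiv.swap i j)) := by
  have key : ∀ i j : ι, ∑ π, (permSum a π - permSum a (π * Equiv.swap i j)) *
        (g π - g (π * Equiv.swap i j)) =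
      2 * ∑ π, (permSum a π - permSum a (π * Equiv.swap i j)) * g π := by
    intro i j
    -- Reindexing by the transposition changes the sign of the increment of `permSum a`, so both
    -- halves of the product contribute equally.
    have h := sum_mul_swap_comp i j
      fun π => (permSum a π - permSum a (π * Equiv.swap i j)) * g π
    simp only [mul_assoc, Equiv.swap_mul_self, mul_one] at h
    have h2 : ∑ π, (permSum a π - permSum a (π * Equiv.swap i j)) * g (π * Equiv.swap i j) =
        -∑ π, (permSum a π - permSum a (π * Equiv.swap i j)) * g π := by
      rw [← h, ← Finset.sum_neg_distrib]
      exact Finset.sum_congr rfl fun π _ => by ring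
    simp only [mul_sub (_ - _), Finset.sum_sub_distrib (f := fun π => _ * g π), h2]
    ring
  simp only [key, ← Finset.mul_sum]
  have h3 : ∑ i, ∑ j, ∑ π, (permSum a π - permSum a (π * Equiv.swap i j)) * g π =
      ∑ π, (∑ i, ∑ j, (permSum a π - permSum a (π * Equiv.swap i j))) * g π := by
    simp only [Finset.sum_mul]
    rw [Finset.sum_comm]
    conv_rhs => rw [Finset.sum_comm]; enter [2, i]; rw [Finset.sum_comm]
    rw [Finset.sum_comm]
  rw [h3]
  simp only [sum_permSum_sub_swap, mul_assoc, ← Finset.mul_sum]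
  ring

lemma abs_exp_sub_exp_le (x y : ℝ) :
    |Real.exp x - Real.exp y| ≤ |x - y| * (Real.exp x + Real.exp y) := by
  wlog h : y ≤ x generalizing x y
  · rw [abs_sub_comm, abs_sub_comm x, add_comm]
    exact this y x (le_of_not_ge h)
  rw [abs_of_nonneg (sub_nonneg.2 (Real.exp_le_exp.2 h)), abs_of_nonneg (sub_nonneg.2 h)]
  have h1 := Real.add_one_le_exp (y - x)
  have h2 : Real.exp y = Real.exp (y - x) * Real.exp x := by rw [← Real.exp_add]; simp
  have h3 := Real.exp_pos x
  have h4 := Real.exp_pos y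
  nlinarith [mul_le_mul_of_nonneg_right h1 h3.le, mul_nonneg (sub_nonneg.2 h) h4.le]

/-- The exchangeable pairs identity with g = exp W. The bound on |exp x - exp y| is symmetric in x
and y, so reindexing merges its two exponentials; averaging `swapEntries` over (i, j) then yields
`permSum d` + `permMean d`. -/
lemma sum_centered_mul_exp_le [Nonempty ι] (a d : ι → ι → ℝ) (W : Equiv.Perm ι → ℝ) (K : ℝ)
    (hB : ∀ π i j, |permSum a π - permSum a (π * Equiv.swap i j)| *
      |W π - W (π * Equiv.swap i j)| ≤ K * swapEntries d π i j) :
    ∑ π, (permSum a π - permMean a) * Real.exp (W π) ≤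
      K * ∑ π, (permSum d π + permMean d) * Real.exp (W π) := by
  have h0 : 0 < (Fintype.card ι : ℝ) := by simp [Fintype.card_pos]
  have h1 : ∀ i j : ι, ∑ π, (permSum a π - permSum a (π * Equiv.swap i j)) *
        (Real.exp (W π) - Real.exp (W (π * Equiv.swap i j))) ≤
      2 * K * ∑ π, swapEntries d π i j * Real.exp (W π) := by
    intro i j
    have h := sum_mul_swap_comp i j fun π => swapEntries d π i j * Real.exp (W π)
    simp only [swapEntries_swap] at h
    calc _ ≤ ∑ π, K * (swapEntries d π i j * Real.exp (W π) +
            swapEntries d π i j * Real.exp (W (π * Equiv.swap i j))) := by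
          refine Finset.sum_le_sum fun π _ => ?_
          have h2 := abs_exp_sub_exp_le (W π) (W (π * Equiv.swap i j))
          calc _ ≤ |permSum a π - permSum a (π * Equiv.swap i j)| *
                |Real.exp (W π) - Real.exp (W (π * Equiv.swap i j))| := by
                rw [← abs_mul]; exact le_abs_self _
            _ ≤ |permSum a π - permSum a (π * Equiv.swap i j)| *
                (|W π - W (π * Equiv.swap i j)| *
                  (Real.exp (W π) + Real.exp (W (π * Equiv.swap i j)))) := by gcongr
            _ ≤ (K * swapEntries d π i j) *
                (Real.exp (W π) + Real.exp (W (π * Equiv.swap i j))) := by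
                rw [← mul_assoc]
                exact mul_le_mul_of_nonneg_right (hB π i j) (by positivity)
            _ = _ := by ring
      _ = _ := by
          rw [← Finset.mul_sum, Finset.sum_add_distrib, h]
          ring
  have h2 := sum_centered_mul a fun π => Real.exp (W π)
  have h3 := Finset.sum_le_sum fun i (_ : i ∈ Finset.univ) =>
    Finset.sum_le_sum fun j (_ : j ∈ Finset.univ) => h1 i j
  have h4 : ∑ i, ∑ j, 2 * K * ∑ π, swapEntries d π i j * Real.exp (W π) =
      4 * (Fintype.card ι : ℝ) *
        (K * ∑ π, (permSum d π + permMean d) * Real.exp (W π)) := by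
    have h5 : ∑ i, ∑ j, ∑ π, swapEntries d π i j * Real.exp (W π) =
        ∑ π, (∑ i, ∑ j, swapEntries d π i j) * Real.exp (W π) := by
      simp only [Finset.sum_mul]
      conv_rhs => rw [Finset.sum_comm]; enter [2, i]; rw [Finset.sum_comm]
    simp only [← Finset.mul_sum]
    rw [h5]
    simp only [sum_swapEntries, mul_assoc, ← Finset.mul_sum]
    ring
  rw [← h2, h4] at h3
  exact le_of_mul_le_mul_left h3 (by positivity)

end Exchangeable

/-! ### Exponential moments and Bernstein's inequality -/

section Concentration

variable {ι : Type*} [Fintype ι] [DecidableEq ι] [Nonempty ι]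

/-- A differential inequality `m' ≤ v' m` on `[0, T]` integrates to `m T ≤ m 0 * exp (v T)`. -/
lemma le_mul_exp_of_deriv_le {m m' v v' : ℝ → ℝ} {T : ℝ} (hT : 0 ≤ T)
    (hm : ∀ t, HasDerivAt m (m' t) t) (hv : ∀ t, HasDerivAt v (v' t) t) (hv0 : v 0 = 0)
    (h : ∀ t, 0 ≤ t → t ≤ T → m' t ≤ v' t * m t) :
    m T ≤ m 0 * Real.exp (v T) := by
  have hd : ∀ t, HasDerivAt (fun t => m t * Real.exp (-v t))
      (m' t * Real.exp (-v t) + m t * (Real.exp (-v t) * -v' t)) t := fun t =>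
    (hm t).mul (hv t).neg.exp
  have hanti : AntitoneOn (fun t => m t * Real.exp (-v t)) (Set.Icc 0 T) := by
    refine antitoneOn_of_deriv_nonpos (convex_Icc 0 T)
      (fun t _ => (hd t).continuousAt.continuousWithinAt)
      (fun t _ => (hd t).differentiableAt.differentiableWithinAt) fun t ht => ?_
    rw [interior_Icc] at ht
    rw [(hd t).deriv]
    nlinarith [mul_le_mul_of_nonneg_right (h t ht.1.le ht.2.le) (Real.exp_pos (-v t)).le]
  have := hanti (Set.left_mem_Icc.2 hT) (Set.right_mem_Icc.2 hT) hT
  simp only [hv0, neg_zero, Real.exp_zero, mul_one, Real.exp_neg] at this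
  rwa [← div_eq_mul_inv, div_le_iff₀ (Real.exp_pos _)] at this

/-- Exponential moment of a permutation sum with entries in `[0, R]`. -/
lemma sum_exp_permSum_le {d : ι → ι → ℝ} {R : ℝ} (hd : ∀ i j, 0 ≤ d i j)
    (hR : ∀ i j, d i j ≤ R) {θ : ℝ} (hθ : 0 ≤ θ) (hθR : 4 * R * θ ≤ 1) :
    ∑ π, Real.exp (θ * permSum d π) ≤
      (Fintype.card (Equiv.Perm ι) : ℝ) * Real.exp (3 * permMean d * θ) := by
  have hm : ∀ t : ℝ, HasDerivAt (fun t => ∑ π, Real.exp (t * permSum d π))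
      (∑ π, permSum d π * Real.exp (t * permSum d π)) t := by
    intro t
    refine HasDerivAt.fun_sum fun π _ => ?_
    have := ((hasDerivAt_id t).mul_const (permSum d π)).exp
    simpa [mul_comm] using this
  have h := le_mul_exp_of_deriv_le hθ hm
    (v := fun t => 3 * permMean d * t) (v' := fun _ => 3 * permMean d)
    (fun t => by simpa using (hasDerivAt_id t).const_mul (3 * permMean d)) (by simp) ?_
  · simpa using h
  intro t ht htθ
  have hR0 : 0 ≤ R := (hd (Classical.arbitrary ι) (Classical.arbitrary ι)).trans (hR _ _)
  have hRt : 4 * R * t ≤ 1 := le_trans (by gcongr) hθR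
  have key := sum_centered_mul_exp_le d d (fun π => t * permSum d π) (2 * R * t) (by
    intro π i j
    rw [← mul_sub, abs_mul, abs_of_nonneg ht]
    have h1 := abs_permSum_sub_swap_le_swapEntries hd π i j
    have h2 : |permSum d π - permSum d (π * Equiv.swap i j)| ≤ 2 * R := by
      rw [permSum_sub_swap, abs_le]
      constructor <;> linarith [hd i (π i), hd j (π j), hd i (π j), hd j (π i),
        hR i (π i), hR j (π j), hR i (π j), hR j (π i)]
    calc _ ≤ 2 * R * (t * swapEntries d π i j) := by gcongr
      _ = _ := by ring)
  simp only [sub_mul, add_mul, Finset.sum_sub_distrib, Finset.sum_add_distrib,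
    ← Finset.mul_sum] at key
  have hA : 0 ≤ ∑ π, permSum d π * Real.exp (t * permSum d π) :=
    Finset.sum_nonneg fun π _ => mul_nonneg (permSum_nonneg hd π) (Real.exp_pos _).le
  have hB : 0 ≤ permMean d * ∑ π, Real.exp (t * permSum d π) :=
    mul_nonneg (permMean_nonneg hd) (Finset.sum_nonneg fun π _ => (Real.exp_pos _).le)
  -- Since 2Rt ≤ 1/2, `key` reads m' - μm ≤ (m' + μm)/2, with m the exponential moment and μ the
  -- mean; hence m' ≤ 3μm.
  nlinarith [mul_le_mul_of_nonneg_right hRt (add_nonneg hA hB)]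

/-- Exponential moment of a centered permutation sum, compensated by its sum of squares. -/
lemma sum_exp_compensated_le {a : ι → ι → ℝ} {M : ℝ} (hM : ∀ i j, |a i j| ≤ M)
    {θ : ℝ} (hθ : 0 ≤ θ) (hθM : 4 * M * θ ≤ 1) :
    ∑ π, Real.exp (θ * (permSum a π - permMean a) -
        4 * θ ^ 2 * permSum (fun i j => a i j ^ 2) π) ≤
      (Fintype.card (Equiv.Perm ι) : ℝ) *
        Real.exp (4 * permMean (fun i j => a i j ^ 2) * θ ^ 2) := by
  set d : ι → ι → ℝ := fun i j => a i j ^ 2 with hd_def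
  have hd : ∀ i j, 0 ≤ d i j := fun i j => sq_nonneg _
  have hm : ∀ t : ℝ, HasDerivAt
      (fun t => ∑ π, Real.exp (t * (permSum a π - permMean a) - 4 * t ^ 2 * permSum d π))
      (∑ π, (permSum a π - permMean a - 8 * t * permSum d π) *
        Real.exp (t * (permSum a π - permMean a) - 4 * t ^ 2 * permSum d π)) t := by
    intro t
    refine HasDerivAt.fun_sum fun π _ => ?_
    have := (((hasDerivAt_id t).mul_const (permSum a π - permMean a)).sub
      ((((hasDerivAt_id t).pow 2).const_mul 4).mul_const (permSum d π))).exp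
    refine this.congr_deriv ?_
    simp
    ring
  have h := le_mul_exp_of_deriv_le hθ hm
    (v := fun t => 4 * permMean d * t ^ 2) (v' := fun t => 8 * permMean d * t)
    (fun t => by
      refine (((hasDerivAt_id t).pow 2).const_mul (4 * permMean d)).congr_deriv ?_
      simp
      ring) (by simp) ?_
  · simpa using h
  intro t ht htθ
  have hM0 : 0 ≤ M := (abs_nonneg _).trans (hM (Classical.arbitrary ι) (Classical.arbitrary ι))
  have hMt : 4 * M * t ≤ 1 := le_trans (by gcongr) hθM
  have key := sum_centered_mul_exp_le a d
    (fun π => t * (permSum a π - permMean a) - 4 * t ^ 2 * permSum d π) (8 * t) (by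
    intro π i j
    have h1 := abs_permSum_sub_swap_le_swapEntries hd π i j
    set δ := permSum a π - permSum a (π * Equiv.swap i j) with hδ
    set ε := permSum d π - permSum d (π * Equiv.swap i j) with hε
    have h2 : |δ| ≤ 4 * M := by
      rw [hδ, permSum_sub_swap, abs_le]
      constructor <;> linarith [abs_le.1 (hM i (π i)), abs_le.1 (hM j (π j)),
        abs_le.1 (hM i (π j)), abs_le.1 (hM j (π i))]
    have h3 : |δ| * |δ| ≤ 4 * swapEntries d π i j := by
      rw [abs_mul_abs_self, hδ, permSum_sub_swap]
      simp only [swapEntries, hd_def]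
      -- Cauchy–Schwarz for four terms: (p + q - r - s)² ≤ 4(p² + q² + r² + s²), the difference
      -- being the sum of these six squares.
      nlinarith [sq_nonneg (a i (π i) - a j (π j)), sq_nonneg (a i (π i) + a i (π j)),
        sq_nonneg (a i (π i) + a j (π i)), sq_nonneg (a j (π j) + a i (π j)),
        sq_nonneg (a j (π j) + a j (π i)), sq_nonneg (a i (π j) - a j (π i))]
    have hS : 0 ≤ swapEntries d π i j := (abs_nonneg _).trans h1
    have h4 : |t * (permSum a π - permMean a) - 4 * t ^ 2 * permSum d π -
        (t * (permSum a (π * Equiv.swap i j) - permMean a) -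
          4 * t ^ 2 * permSum d (π * Equiv.swap i j))| ≤ t * |δ| + 4 * t ^ 2 * |ε| := by
      have h5 : t * (permSum a π - permMean a) - 4 * t ^ 2 * permSum d π -
        (t * (permSum a (π * Equiv.swap i j) - permMean a) -
          4 * t ^ 2 * permSum d (π * Equiv.swap i j)) = t * δ - 4 * t ^ 2 * ε := by
        rw [hδ, hε]; ring
      rw [h5]
      refine (abs_sub _ _).trans ?_
      rw [abs_mul, abs_mul, abs_of_nonneg ht, abs_of_nonneg (by positivity : 0 ≤ 4 * t ^ 2)]
    calc _ ≤ |δ| * (t * |δ| + 4 * t ^ 2 * |ε|) := by gcongr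
      _ = t * (|δ| * |δ|) + 4 * t ^ 2 * (|δ| * |ε|) := by ring
      _ ≤ t * (4 * swapEntries d π i j) + 4 * t ^ 2 * (4 * M * swapEntries d π i j) := by
          gcongr
      _ = 4 * t * swapEntries d π i j * (1 + 4 * M * t) := by ring
      _ ≤ 4 * t * swapEntries d π i j * (1 + 1) := by gcongr
      _ = _ := by ring)
  -- The factor 8t is the derivative of 4t², so the compensator cancels the `permSum d` term exactly
  -- and only 8t · `permMean d` remains.
  simp only [add_mul, Finset.sum_add_distrib, ← Finset.mul_sum] at key
  simp only [sub_mul _ (8 * t * _), Finset.sum_sub_distrib, mul_assoc (8 * t), ← Finset.mul_sum]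
  linarith

lemma card_filter_lt_le {α : Type*} [Fintype α] {W : α → ℝ} {u L : ℝ}
    (h : ∑ π, Real.exp (W π) ≤ (Fintype.card α : ℝ) * Real.exp u) :
    ((Finset.univ.filter fun π => u + L < W π).card : ℝ) ≤
      (Fintype.card α : ℝ) * Real.exp (-L) := by
  have h1 : ((Finset.univ.filter fun π => u + L < W π).card : ℝ) * Real.exp (u + L) ≤
      ∑ π, Real.exp (W π) := by
    rw [← nsmul_eq_mul]
    refine (Finset.card_nsmul_le_sum _ (fun π => Real.exp (W π)) _ fun π hπ => ?_).trans
      (Finset.sum_le_sum_of_subset_of_nonneg (Finset.subset_univ _)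
        fun _ _ _ => (Real.exp_pos _).le)
    exact (Real.exp_lt_exp.2 (Finset.mem_filter.1 hπ).2).le
  have h2 := h1.trans h
  rw [Real.exp_add] at h2
  rw [Real.exp_neg, ← div_eq_mul_inv, le_div_iff₀ (Real.exp_pos _)]
  refine le_of_mul_le_mul_right (le_of_eq_of_le ?_ h2) (Real.exp_pos u)
  ring

/-- The witness is θ = min(√(L/V), 1/(4M)): the optimal scale, capped by the constraint on θ. -/
lemma exists_bernstein_parameter {M V L : ℝ} (hM : 0 < M) (hV : 0 ≤ V) (hL : 0 < L) :
    ∃ θ, 0 < θ ∧ 4 * M * θ ≤ 1 ∧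
      16 * V * θ + 4 * M * L + L / θ ≤ 17 * (Real.sqrt V * Real.sqrt L) + 8 * M * L := by
  have hsL := Real.sqrt_pos.2 hL
  have eV := Real.mul_self_sqrt hV
  have eL := Real.mul_self_sqrt hL.le
  have hsV := Real.sqrt_nonneg V
  set v := Real.sqrt V
  set l := Real.sqrt L
  rw [← eV, ← eL]
  by_cases h : v ≤ 4 * M * l
  · refine ⟨1 / (4 * M), by positivity, le_of_eq (by field_simp), ?_⟩
    have h1 : 16 * (v * v) * (1 / (4 * M)) ≤ 16 * (v * l) := by
      rw [mul_one_div, div_le_iff₀ (by positivity)]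
      nlinarith [mul_le_mul_of_nonneg_left h hsV]
    have h2 : l * l / (1 / (4 * M)) = 4 * M * (l * l) := by field_simp
    rw [h2]
    nlinarith [mul_nonneg hsV hsL.le]
  · have hv : 0 < v := lt_of_le_of_lt (by positivity) (not_le.1 h)
    refine ⟨l / v, by positivity, ?_, ?_⟩
    · rw [← mul_div_assoc, div_le_one hv]
      exact (not_le.1 h).le
    · have h1 : 16 * (v * v) * (l / v) = 16 * (v * l) := by field_simp
      have h2 : l * l / (l / v) = v * l := by field_simp
      rw [h1, h2]
      nlinarith [mul_pos hM (mul_pos hsL hsL)]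

/-- Bernstein's inequality for permutation sums. -/
lemma card_bernstein_le {a : ι → ι → ℝ} {M : ℝ} (hM : ∀ i j, |a i j| ≤ M) {α : ℝ}
    (hα : 0 < α) (hα1 : α < 1) :
    ((Finset.univ.filter fun π =>
        17 * (Real.sqrt (permMean fun i j => a i j ^ 2) * Real.sqrt (Real.log (2 / α)) +
          M * Real.log (2 / α)) < permSum a π - permMean a).card : ℝ) ≤
      (Fintype.card (Equiv.Perm ι) : ℝ) * α := by
  set L := Real.log (2 / α) with hLdef
  have hL : 0 < L := Real.log_pos (by rw [lt_div_iff₀ hα]; linarith)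
  have hexp : Real.exp (-L) = α / 2 := by
    rw [hLdef, Real.exp_neg, Real.exp_log (by positivity), inv_div]
  have hM0 : 0 ≤ M := (abs_nonneg _).trans (hM (Classical.arbitrary ι) (Classical.arbitrary ι))
  -- M = 0 is separate because the exponential parameters divide by M.
  rcases hM0.eq_or_lt with rfl | hMpos
  · have ha : a = 0 := by
      ext i j
      simpa using hM i j
    subst ha
    simp [permSum, permMean]
    positivity
  set d : ι → ι → ℝ := fun i j => a i j ^ 2 with hd_def
  have hd : ∀ i j, 0 ≤ d i j := fun i j => sq_nonneg _
  have hdM : ∀ i j, d i j ≤ M ^ 2 := fun i j =>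
    sq_le_sq' (abs_le.1 (hM i j)).1 (abs_le.1 (hM i j)).2
  obtain ⟨θ, hθ, hθM, hbd⟩ := exists_bernstein_parameter hMpos (permMean_nonneg hd) hL
  have h1 := card_filter_lt_le (L := L) (sum_exp_compensated_le hM hθ.le hθM)
  -- 1/(4M²) is the largest parameter allowed for entries in [0, M²]. Each of the two tail events
  -- below has proportion at most exp(-L) = α/2, which explains the 2 in log(2/α).
  have hs : 4 * M ^ 2 * (1 / (4 * M ^ 2)) ≤ 1 := le_of_eq (by field_simp)
  have h2 := card_filter_lt_le (L := L) (sum_exp_permSum_le hd hdM (by positivity) hs)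
  rw [hexp] at h1 h2
  have hsub := Finset.card_le_card (s := Finset.univ.filter fun π =>
        17 * (Real.sqrt (permMean d) * Real.sqrt L + M * L) < permSum a π - permMean a)
    (t := (Finset.univ.filter fun π => 4 * permMean d * θ ^ 2 + L <
        θ * (permSum a π - permMean a) - 4 * θ ^ 2 * permSum d π) ∪
      Finset.univ.filter fun π => 3 * permMean d * (1 / (4 * M ^ 2)) + L <
        1 / (4 * M ^ 2) * permSum d π) (by
    intro π hπ
    simp only [Finset.mem_union, Finset.mem_filter, Finset.mem_univ, true_and] at hπ ⊢
    by_contra! hcon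
    obtain ⟨hc1, hc2⟩ := hcon
    refine absurd hπ (not_lt.2 ?_)
    have hD : permSum d π ≤ 3 * permMean d + 4 * M ^ 2 * L := by
      have := mul_le_mul_of_nonneg_left hc2 (by positivity : 0 ≤ 4 * M ^ 2)
      field_simp at this
      linarith
    have hF : permSum a π - permMean a ≤ 4 * θ * permSum d π + 4 * permMean d * θ + L / θ := by
      rw [← mul_le_mul_iff_right₀ hθ]
      have : θ * (4 * θ * permSum d π + 4 * permMean d * θ + L / θ) =
        4 * θ ^ 2 * permSum d π + 4 * permMean d * θ ^ 2 + L := by field_simp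
      rw [this]
      linarith
    have h3 : 4 * θ * permSum d π ≤ 4 * θ * (3 * permMean d + 4 * M ^ 2 * L) := by gcongr
    have h4 : 4 * M * θ * (4 * M * L) ≤ 1 * (4 * M * L) := by gcongr
    have h5 : 0 < M * L := by positivity
    nlinarith)
  have h3 : ((Finset.univ.filter fun π =>
        17 * (Real.sqrt (permMean d) * Real.sqrt L + M * L) < permSum a π - permMean a).card : ℝ) ≤
      _ := Nat.cast_le.2 (hsub.trans (Finset.card_union_le _ _))
  push_cast at h3
  linarith

end Concentration

/-! ### From tail counts to the critical value -/

section CriticalValue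

lemma orderStat_le_of_card_le {ι : Type*} [Fintype ι] (f : ι → ℝ) {k : ℕ} {B : ℝ}
    (hk : k < Fintype.card ι) (h : (Finset.univ.filter fun i => B < f i).card ≤ k) :
    orderStat f (Fintype.card ι - k) ≤ B := by
  have hlen : (orderedValues f).length = Fintype.card ι := by
    simp [orderedValues]
  have hidx : Fintype.card ι - k - 1 < (orderedValues f).length := by omega
  unfold orderStat
  rw [List.getD_eq_getElem _ _ hidx]
  by_contra! hlt
  have hsort : (orderedValues f).Pairwise (· ≤ ·) := Multiset.pairwise_sort _ _
  -- If the entry of rank card ι - k (index one less) exceeded B, so would all the entries from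
  -- there on; these are k + 1 in number, one too many.
  have hall : ∀ y ∈ (orderedValues f).drop (Fintype.card ι - k - 1), B < y := by
    intro y hy
    obtain ⟨m, hm, rfl⟩ := List.getElem_of_mem hy
    rw [List.getElem_drop]
    refine hlt.trans_le ?_
    rcases Nat.eq_zero_or_pos m with rfl | hm0
    · simp
    · exact List.pairwise_iff_getElem.1 hsort _ _ hidx _ (by omega)
  have hcount : (orderedValues f).countP (fun y => decide (B < y)) =
      (Finset.univ.filter fun i => B < f i).card := by
    rw [← Multiset.coe_countP]
    have : ((orderedValues f : List ℝ) : Multiset ℝ) = Finset.univ.val.map f :=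
      Multiset.sort_eq _ _
    rw [this, Multiset.countP_map]
    rfl
  have h1 : ((orderedValues f).drop (Fintype.card ι - k - 1)).countP
      (fun y => decide (B < y)) = k + 1 := by
    rw [List.countP_eq_length.2 (by simpa using hall), List.length_drop, hlen]
    omega
  have h2 := (List.drop_sublist (Fintype.card ι - k - 1) (orderedValues f)).countP_le
    (p := fun y => decide (B < y))
  omega

lemma testStat_permSample {S : Type*} {n : ℕ} (φ : S × S → ℝ) (x : Fin n → S × S)
    (π : Equiv.Perm (Fin n)) :
    testStat φ (permSample x π) = 1 / ((n : ℝ) - 1) *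
      (permSum (fun i j => φ ((x i).1, (x j).2)) π -
        permMean fun i j => φ ((x i).1, (x j).2)) := by
  simp only [testStat, permSample, permSum, permMean, Fintype.card_fin]
  rw [sum_sum_comp_perm (fun i j => φ ((x i).1, (x j).2)) π]

lemma criticalValue_le {S : Type*} (φ : S × S → ℝ) (hφ : BddAbove (Set.range fun z => |φ z|))
    {n : ℕ} (hn : 2 ≤ n) {α : ℝ} (hα : 0 < α) (hα1 : α < 1) (x : Fin n → S × S) :
    criticalValue φ α x ≤
      17 / ((n : ℝ) - 1) *
        (Real.sqrt (1 / (n : ℝ) * ∑ i, ∑ j, φ ((x i).1, (x j).2) ^ 2)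
            * Real.sqrt (Real.log (2 / α))
          + supNorm φ * Real.log (2 / α)) := by
  have : Nonempty (Fin n) := ⟨⟨0, by omega⟩⟩
  have hn1 : (0 : ℝ) < (n : ℝ) - 1 := by
    have : (2 : ℝ) ≤ n := by exact_mod_cast hn
    linarith
  have hcard : Fintype.card (Equiv.Perm (Fin n)) = n.factorial := by
    rw [Fintype.card_perm, Fintype.card_fin]
  have hB := card_bernstein_le (a := fun i j => φ ((x i).1, (x j).2)) (M := supNorm φ)
    (fun i j => le_ciSup hφ ((x i).1, (x j).2)) hα hα1
  rw [hcard] at hB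
  unfold criticalValue
  rw [← hcard]
  apply orderStat_le_of_card_le
  · rw [hcard, Nat.floor_lt (by positivity)]
    have : (0 : ℝ) < n.factorial := by positivity
    nlinarith
  · rw [hcard]
    refine Nat.le_floor (le_trans (Nat.cast_le.2 (Finset.card_le_card ?_)) hB)
    intro π hπ
    simp only [Finset.mem_filter, Finset.mem_univ, true_and, testStat_permSample] at hπ ⊢
    rw [div_mul_eq_mul_div, one_div_mul_eq_div _ (permSum _ π - _),
      div_lt_div_iff_of_pos_right hn1] at hπ
    simpa only [permMean, Fintype.card_fin] using hπ

end CriticalValue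

/-! ### The quantile of the critical value -/

section Quantile

variable {Ω : Type*} [MeasurableSpace Ω] {μ : Measure Ω}

lemma quantile_le {Y : Ω → ℝ} {p t : ℝ} (ht : 0 ≤ t) (h : p ≤ μ.real {ω | Y ω ≤ t}) :
    quantile μ Y p ≤ t := by
  unfold quantile
  by_cases hb : BddBelow {t : ℝ | p ≤ μ.real {ω | Y ω ≤ t}}
  · exact csInf_le hb h
  · rw [Real.sInf_of_not_bddBelow hb]
    exact ht

variable [IsProbabilityMeasure μ]

/-- Markov's inequality as a lower bound on the probability of not exceeding a multiple of
the mean. -/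
lemma one_sub_le_measureReal_le {V : Ω → ℝ} (hV : ∀ ω, 0 ≤ V ω) (hint : Integrable V μ)
    {b : ℝ} (hb : 0 < b) : 1 - b ≤ μ.real {ω | V ω ≤ 1 / b * ∫ ω, V ω ∂μ} := by
  -- Subadditivity replaces the complement rule, since `V` is only a.e. measurable.
  have h1 : μ.real (Set.univ : Set Ω) ≤ μ.real {ω | V ω ≤ 1 / b * ∫ ω, V ω ∂μ} +
      μ.real {ω | 1 / b * ∫ ω, V ω ∂μ < V ω} := by
    refine le_trans (measureReal_mono ?_) (measureReal_union_le _ _)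
    intro ω _
    exact le_or_gt (V ω) (1 / b * ∫ ω, V ω ∂μ)
  rw [probReal_univ] at h1
  have h2 : μ.real {ω | 1 / b * ∫ ω, V ω ∂μ < V ω} ≤ b := by
    -- With zero mean, Markov's inequality at level 0 is void, but then `V` vanishes almost
    -- everywhere.
    rcases (integral_nonneg hV : 0 ≤ ∫ ω, V ω ∂μ).eq_or_lt with h0 | hpos
    · have hae := (integral_eq_zero_iff_of_nonneg hV hint).1 h0.symm
      have hz : μ {ω | 1 / b * ∫ ω, V ω ∂μ < V ω} = 0 := by
        refine measure_mono_null (fun ω hω => ?_) hae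
        simp only [← h0, mul_zero, Set.mem_ofPred_eq] at hω
        exact hω.ne'
      rw [measureReal_def, hz]
      simpa using hb.le
    · have hM := mul_meas_ge_le_integral_of_nonneg (Filter.Eventually.of_forall hV) hint
        (1 / b * ∫ ω, V ω ∂μ)
      have hmono : μ.real {ω | 1 / b * ∫ ω, V ω ∂μ < V ω} ≤
          μ.real {ω | 1 / b * ∫ ω, V ω ∂μ ≤ V ω} :=
        measureReal_mono <| Set.ofPred_subset_ofPred.2 fun ω hω => hω.le
      refine hmono.trans ?_
      rw [one_div_mul_eq_div, div_mul_eq_mul_div, div_le_iff₀ hb, mul_comm] at hM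
      rw [one_div_mul_eq_div]
      nlinarith
  linarith

variable {S : Type*} [MeasurableSpace S] {P : Measure (S × S)}

lemma hasLaw_fst_snd_of_indepFun {X Y : Ω → S × S} (hX : HasLaw X P μ) (hY : HasLaw Y P μ)
    (h : IndepFun X Y μ) :
    HasLaw (fun ω => ((X ω).1, (Y ω).2)) (P.fst.prod P.snd) μ where
  aemeasurable := hX.aemeasurable.fst.prodMk hY.aemeasurable.snd
  map_eq := by
    have h1 : IndepFun (fun ω => (X ω).1) (fun ω => (Y ω).2) μ :=
      h.comp measurable_fst measurable_snd
    rw [(indepFun_iff_map_prod_eq_prod_map_map hX.aemeasurable.fst hY.aemeasurable.snd).1 h1,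
      Measure.fst, Measure.snd, ← hX.map_eq,
      AEMeasurable.map_map_of_aemeasurable measurable_fst.aemeasurable hX.aemeasurable,
      hX.map_eq, ← hY.map_eq,
      AEMeasurable.map_map_of_aemeasurable measurable_snd.aemeasurable hY.aemeasurable]
    rfl

lemma integrable_sq_comp {φ : S × S → ℝ} (hm : Measurable φ)
    (hφ : BddAbove (Set.range fun z => |φ z|)) {Z : Ω → S × S} (hZ : AEMeasurable Z μ) :
    Integrable (fun ω => φ (Z ω) ^ 2) μ := by
  refine Integrable.of_bound (C := supNorm φ ^ 2)
    ((hm.pow_const 2).comp_aemeasurable hZ).aestronglyMeasurable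
    (Filter.Eventually.of_forall fun ω => ?_)
  rw [Real.norm_eq_abs, abs_pow]
  exact pow_le_pow_left₀ (abs_nonneg _) (le_ciSup hφ (Z ω)) 2

lemma integral_sum_sq [IsProbabilityMeasure P] {φ : S × S → ℝ} (hm : Measurable φ)
    (hφ : BddAbove (Set.range fun z => |φ z|)) {n : ℕ} {X : Fin n → Ω → S × S}
    (hX : ∀ i, HasLaw (X i) P μ) (hind : iIndepFun X μ) :
    Integrable (fun ω => ∑ i, ∑ j, φ ((X i ω).1, (X j ω).2) ^ 2) μ ∧
    ∫ ω, ∑ i, ∑ j, φ ((X i ω).1, (X j ω).2) ^ 2 ∂μ =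
      n * expJoint P (fun z => φ z ^ 2) +
        n * ((n : ℝ) - 1) * expIndep P (fun z => φ z ^ 2) := by
  have hint : ∀ i j, Integrable (fun ω => φ ((X i ω).1, (X j ω).2) ^ 2) μ := fun i j =>
    integrable_sq_comp hm hφ ((hX i).aemeasurable.fst.prodMk (hX j).aemeasurable.snd)
  refine ⟨integrable_finsetSum _ fun i _ => integrable_finsetSum _ fun j _ => hint i j, ?_⟩
  rw [integral_finsetSum _ fun i _ => integrable_finsetSum _ fun j _ => hint i j]
  -- Diagonal pairs have law P; off the diagonal, independence gives the product of the marginals.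
  have hval : ∀ i j, ∫ ω, φ ((X i ω).1, (X j ω).2) ^ 2 ∂μ =
      expIndep P (fun z => φ z ^ 2) + if i = j then
        expJoint P (fun z => φ z ^ 2) - expIndep P (fun z => φ z ^ 2) else 0 := by
    intro i j
    split_ifs with hij
    · subst hij
      rw [add_sub_cancel]
      exact (hX i).integral_comp (hm.pow_const 2).aestronglyMeasurable
    · rw [add_zero]
      exact (hasLaw_fst_snd_of_indepFun (hX i) (hX j) (hind.indepFun hij)).integral_comp
        (hm.pow_const 2).aestronglyMeasurable
  have hsum : ∀ i, ∫ ω, ∑ j, φ ((X i ω).1, (X j ω).2) ^ 2 ∂μ =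
      n * expIndep P (fun z => φ z ^ 2) +
        (expJoint P (fun z => φ z ^ 2) - expIndep P (fun z => φ z ^ 2)) := by
    intro i
    rw [integral_finsetSum _ fun j _ => hint i j]
    simp [hval, Finset.sum_add_distrib]
  simp only [hsum, Finset.sum_const, Finset.card_univ, Fintype.card_fin, nsmul_eq_mul]
  ring

lemma quantile_criticalValue_le [IsProbabilityMeasure P] {φ : S × S → ℝ} (hm : Measurable φ)
    (hφ : BddAbove (Set.range fun z => |φ z|)) {n : ℕ} (hn : 2 ≤ n) {X : Fin n → Ω → S × S}
    (hX : ∀ i, HasLaw (X i) P μ) (hind : iIndepFun X μ)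
    {α β : ℝ} (hα : 0 < α) (hα1 : α < 1) (hβ : 0 < β) :
    quantile μ (fun ω => criticalValue φ α (fun i => X i ω)) (1 - β / 2) ≤
      34 * (Real.sqrt (2 / β * Real.log (2 / α)) *
          (Real.sqrt (expJoint P (fun z => φ z ^ 2)) / (n : ℝ)
            + Real.sqrt (expIndep P (fun z => φ z ^ 2)) / Real.sqrt (n : ℝ))
        + supNorm φ / (n : ℝ) * Real.log (2 / α)) := by
  have hn2 : (2 : ℝ) ≤ n := by exact_mod_cast hn
  have hn1 : (0 : ℝ) < (n : ℝ) - 1 := by linarith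
  have hn0 : (0 : ℝ) < n := by linarith
  have hL : 0 < Real.log (2 / α) := Real.log_pos (by rw [lt_div_iff₀ hα]; linarith)
  have hsup : 0 ≤ supNorm φ := Real.iSup_nonneg fun z => abs_nonneg _
  have hEP : 0 ≤ expJoint P (fun z => φ z ^ 2) := integral_nonneg fun z => sq_nonneg _
  have hEI : 0 ≤ expIndep P (fun z => φ z ^ 2) := integral_nonneg fun z => sq_nonneg _
  obtain ⟨hint, hval⟩ := integral_sum_sq hm hφ hX hind
  have hmarkov := one_sub_le_measureReal_le (μ := μ)
    (V := fun ω => 1 / (n : ℝ) * ∑ i, ∑ j, φ ((X i ω).1, (X j ω).2) ^ 2)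
    (fun ω => by positivity) (hint.const_mul _) (b := β / 2) (by positivity)
  rw [integral_const_mul, hval] at hmarkov
  -- Only the inclusion of the Markov event is needed, so measurability of the critical value plays
  -- no role.
  refine quantile_le (by positivity) (hmarkov.trans (measureReal_mono fun ω hω => ?_))
  simp only [Set.mem_ofPred_eq] at hω ⊢
  refine (criticalValue_le φ hφ hn hα hα1 _).trans ?_
  set EP := expJoint P (fun z => φ z ^ 2)
  set EI := expIndep P (fun z => φ z ^ 2)
  set L := Real.log (2 / α)
  have hmean : 1 / (β / 2) * (1 / (n : ℝ) * (n * EP + n * ((n : ℝ) - 1) * EI)) ≤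
      2 / β * (EP + n * EI) := by
    have : 1 / (β / 2) * (1 / (n : ℝ) * (n * EP + n * ((n : ℝ) - 1) * EI)) =
        2 / β * (EP + (n - 1) * EI) := by field_simp
    rw [this]
    gcongr
    linarith
  have hsqrt : Real.sqrt (EP + n * EI) ≤ Real.sqrt EP + Real.sqrt n * Real.sqrt EI := by
    rw [← Real.sqrt_mul hn0.le]
    refine Real.sqrt_le_iff.2 ⟨by positivity, ?_⟩
    have h1 := Real.sq_sqrt hEP
    have h2 := Real.sq_sqrt (by positivity : 0 ≤ n * EI)
    nlinarith [mul_nonneg (Real.sqrt_nonneg EP) (Real.sqrt_nonneg (n * EI))]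
  -- n ≥ 2 gives n ≤ 2(n - 1), hence the doubling of 17.
  have hcoef : 17 / ((n : ℝ) - 1) ≤ 34 / n := by
    rw [div_le_div_iff₀ hn1 hn0]
    linarith
  have hsn : Real.sqrt n / n = 1 / Real.sqrt n := Real.sqrt_div_self'
  calc _ ≤ 34 / (n : ℝ) * (Real.sqrt (2 / β * (EP + n * EI)) * Real.sqrt L + supNorm φ * L) := by
        have := Real.sqrt_le_sqrt (hω.trans hmean)
        gcongr
    _ = 34 / (n : ℝ) * (Real.sqrt (2 / β * L) * Real.sqrt (EP + n * EI) + supNorm φ * L) := by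
        rw [← Real.sqrt_mul (by positivity), ← Real.sqrt_mul (by positivity)]
        ring_nf
    _ ≤ 34 / (n : ℝ) * (Real.sqrt (2 / β * L) *
          (Real.sqrt EP + Real.sqrt n * Real.sqrt EI) + supNorm φ * L) := by gcongr
    _ = 34 * (Real.sqrt (2 / β * L) * (Real.sqrt EP / n + Real.sqrt EI * (Real.sqrt n / n)) +
          supNorm φ / n * L) := by ring
    _ = _ := by rw [hsn, mul_one_div]

end Quantile

end PermTest

theorem proposition3p1 :
    ∃ C' c₀ : ℝ, 0 < C' ∧ 1 ≤ c₀ ∧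
      (∀ (S : Type*) [MeasurableSpace S] (φ : S × S → ℝ) (_ : Measurable φ)
        (_ : BddAbove (Set.range fun z => |φ z|))
        (n : ℕ) (_ : 2 ≤ n) (α : ℝ) (_ : 0 < α) (_ : α < 1) (x : Fin n → S × S),
        PermTest.criticalValue φ α x ≤
          C' / ((n : ℝ) - 1) *
            (Real.sqrt (1 / (n : ℝ) * ∑ i, ∑ j, φ ((x i).1, (x j).2) ^ 2)
                * Real.sqrt (Real.log (c₀ / α))
              + PermTest.supNorm φ * Real.log (c₀ / α))) ∧
      ∃ C : ℝ, 0 < C ∧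
        ∀ (S : Type*) [MeasurableSpace S] (φ : S × S → ℝ) (_ : Measurable φ)
          (_ : BddAbove (Set.range fun z => |φ z|))
          (P : Measure (S × S)) [IsProbabilityMeasure P]
          (Ω : Type*) [MeasurableSpace Ω] (μ : Measure Ω) [IsProbabilityMeasure μ]
          (n : ℕ) (_ : 2 ≤ n) (X : Fin n → Ω → S × S)
          (_ : ∀ i, HasLaw (X i) P μ) (_ : iIndepFun X μ)
          (α β : ℝ) (_ : 0 < α) (_ : α < 1) (_ : 0 < β) (_ : β < 1),
          PermTest.quantile μ (fun ω => PermTest.criticalValue φ α (fun i => X i ω)) (1 - β / 2) ≤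
            C * (Real.sqrt (2 / β * Real.log (c₀ / α)) *
                  (Real.sqrt (PermTest.expJoint P (fun z => φ z ^ 2)) / (n : ℝ)
                    + Real.sqrt (PermTest.expIndep P (fun z => φ z ^ 2)) / Real.sqrt (n : ℝ))
                + PermTest.supNorm φ / (n : ℝ) * Real.log (c₀ / α)) := by
  refine ⟨17, 2, by norm_num, by norm_num, ?_, 34, by norm_num, ?_⟩
  · intro S _ φ _ hφ n hn α hα hα1 x
    exact PermTest.criticalValue_le φ hφ hn hα hα1 x
  · intro S _ φ hm hφ P _ Ω _ μ _ n hn X hX hind α β hα hα1 hβ _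
    exact PermTest.quantile_criticalValue_le hm hφ hn hX hind hα hα1 hβ
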